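/- Let $K$ be an algebraically closed field, let $A$ be a finite-dimensional $K$-algebra, and let $A\text{-mod}$ be the category of finite-dimensional left $A$-modules. A \emph{module class} is a full subcategory of $A\text{-mod}$, closed under isomorphisms, such that $X\oplus Y$ lies in it if and only if both $X$ and $Y$ do. For a module $X$, $\operatorname{add}X$ is the smallest module class containing $X$, and $\operatorname{gen}X$ is the class of all quotients of modules in $\operatorname{add}X$. A \emph{torsion class} is a module class $\mathcal T$ for which there is a module class $\mathcal F$ with $\operatorname{Hom}_A(\mathcal T,\mathcal F)=0$ such that every $X\in A\text{-mod}$ has a submodule $tX\in\mathcal T$ with $X/tX\in\mathcal F$. A \emph{$\mathcal T$-envelope} of $X$ is a map $\theta\colon X\to Y$ with $Y\in\mathcal T$ such that every map from $X$ to a module in $\mathcal T$ factors through $\theta$, and such that every $\alpha\in\operatorname{End}_A(Y)$ with $\alpha\theta=\theta$ is invertible; \emph{$\mathcal T$-covers} $Y\to X$ are defined dually. $\mathcal T$ is \emph{functorially finite} if every module in $A\text{-mod}$ has a $\mathcal T$-envelope and a $\mathcal T$-cover. A module $M\in\mathcal T$ is \emph{Ext-projective} in $\mathcal T$ if $\operatorname{Ext}^1_A(M,X)=0$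 for all $X\in\mathcal T$, and \emph{split-projective} in $\mathcal T$ if every surjection $X\to M$ with $X\in\mathcal T$ splits. Let $\tau=D\operatorname{Tr}$ be the Auslander--Reiten translate, that is $\tau M=\ker(\nu P_1\to\nu P_0)$ for a minimal projective presentation $P_1\to P_0\to M\to 0$ and $\nu=\operatorname{Hom}_K(\operatorname{Hom}_A(-,A),K)$; $M$ is \emph{$\tau$-rigid} if $\operatorname{Hom}_A(M,\tau M)=0$. \textbf{Theorem.} Let $\mathcal T$ be a functorially finite torsion class in $A\text{-mod}$, let $f\colon A\to T$ be a $\mathcal T$-envelope of the left $A$-module $A$, and put $T'=T\oplus\operatorname{coker}f$. Then: \begin{enumerate} \item $\mathcal T=\operatorname{gen}T=\operatorname{gen}T'$. \item $T$ is split-projective in $\mathcal T$. \item $T$ and $T'$ are Ext-projective in $\mathcal T$, and they are $\tau$-rigid. \item For every $X\in\mathcal T$ there is a surjection $\varphi\colon W\to X$ with $W\in\operatorname{add}T'$ and $\ker\varphi\in\mathcal T$. \item Every Ext-projective module in $\mathcal T$ lies in $\operatorname{add}T'$. \end{enumerate} -/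

import Mathlib

open CategoryTheory

universe u

section ModuleClasses

variable {A : Type u} [Ring A]

/-- A module class in the category `A-mod` of finite-dimensional left `A`-modules: a full
subcategory closed under isomorphisms such that `X` and `Y` belong to it iff `X ⊕ Y` does.
(Over a finite-dimensional algebra `A`, the finite-dimensional `A`-modules are exactly the
`A`-modules which are finitely generated over `A`.) -/
structure IsModuleClass (C : ObjectProperty (ModuleCat.{u} A)) : Prop where
  finite : ∀ X : ModuleCat.{u} A, C X → Module.Finite A X
  iso : ∀ X Y : ModuleCat.{u} A, Nonempty (X ≅ Y) → C X → C Y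
  sum : ∀ X Y : ModuleCat.{u} A, (C X ∧ C Y) ↔ C (ModuleCat.of A (X × Y))

/-- `add X`: the smallest module class containing the finite-dimensional module `X`. -/
def addClass (X : ModuleCat.{u} A) : ObjectProperty (ModuleCat.{u} A) :=
  fun M => ∀ C : ObjectProperty (ModuleCat.{u} A), IsModuleClass C → C X → C M

/-- `gen X`: the modules which are quotients of a module in `add X`. -/
def genClass (X : ModuleCat.{u} A) : ObjectProperty (ModuleCat.{u} A) :=
  fun M => ∃ (W : ModuleCat.{u} A) (p : W ⟶ M), addClass X W ∧ Function.Surjective p.hom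

/-- A torsion theory `(𝒯, ℱ)` in the category of finite-dimensional `A`-modules. -/
structure IsTorsionTheory (𝒯 ℱ : ObjectProperty (ModuleCat.{u} A)) : Prop where
  torsion : IsModuleClass 𝒯
  torsionFree : IsModuleClass ℱ
  hom_eq_zero : ∀ X Y : ModuleCat.{u} A, 𝒯 X → ℱ Y → ∀ g : X ⟶ Y, g = 0
  exists_sequence : ∀ X : ModuleCat.{u} A, Module.Finite A X →
    ∃ tX : Submodule A X, 𝒯 (ModuleCat.of A tX) ∧ ℱ (ModuleCat.of A (X ⧸ tX))

/-- A torsion class: the first component of some torsion theory. -/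
def IsTorsionClass (𝒯 : ObjectProperty (ModuleCat.{u} A)) : Prop :=
  ∃ ℱ : ObjectProperty (ModuleCat.{u} A), IsTorsionTheory 𝒯 ℱ

/-- `θ : X ⟶ Y` is codomain minimal ("left minimal"). -/
def IsCodomainMinimal {X Y : ModuleCat.{u} A} (θ : X ⟶ Y) : Prop :=
  ∀ α : Y ⟶ Y, θ ≫ α = θ → IsIso α

/-- `θ : X ⟶ Y` is domain minimal ("right minimal"). -/
def IsDomainMinimal {X Y : ModuleCat.{u} A} (θ : X ⟶ Y) : Prop :=
  ∀ β : X ⟶ X, β ≫ θ = θ → IsIso β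

/-- `θ : X ⟶ Y` is a `C`-envelope of `X`: a codomain minimal `C`-preenvelope. -/
structure IsEnvelope (C : ObjectProperty (ModuleCat.{u} A)) {X Y : ModuleCat.{u} A}
    (θ : X ⟶ Y) : Prop where
  mem : C Y
  factors : ∀ (Z : ModuleCat.{u} A), C Z → ∀ g : X ⟶ Z, ∃ g' : Y ⟶ Z, θ ≫ g' = g
  minimal : IsCodomainMinimal θ

/-- `θ : Y ⟶ X` is a `C`-cover of `X`: a domain minimal `C`-precover. -/
structure IsCover (C : ObjectProperty (ModuleCat.{u} A)) {X Y : ModuleCat.{u} A}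
    (θ : Y ⟶ X) : Prop where
  mem : C Y
  factors : ∀ (Z : ModuleCat.{u} A), C Z → ∀ g : Z ⟶ X, ∃ g' : Z ⟶ Y, g' ≫ θ = g
  minimal : IsDomainMinimal θ

/-- Every finite-dimensional module has a `C`-envelope. -/
def IsCovariantlyFinite (C : ObjectProperty (ModuleCat.{u} A)) : Prop :=
  ∀ X : ModuleCat.{u} A, Module.Finite A X →
    ∃ (Y : ModuleCat.{u} A) (θ : X ⟶ Y), IsEnvelope C θ

/-- Every finite-dimensional module has a `C`-cover. -/
def IsContravariantlyFinite (C : ObjectProperty (ModuleCat.{u} A)) : Prop :=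
  ∀ X : ModuleCat.{u} A, Module.Finite A X →
    ∃ (Y : ModuleCat.{u} A) (θ : Y ⟶ X), IsCover C θ

/-- Functorially finite: covariantly and contravariantly finite. -/
def IsFunctoriallyFinite (C : ObjectProperty (ModuleCat.{u} A)) : Prop :=
  IsCovariantlyFinite C ∧ IsContravariantlyFinite C

/-- `M` is Ext-projective in `C`: `M` lies in `C` and `Ext¹_A(M, X) = 0` for all `X` in `C`. -/
def IsExtProjective (C : ObjectProperty (ModuleCat.{u} A)) (M : ModuleCat.{u} A) : Prop :=
  C M ∧ ∀ X : ModuleCat.{u} A, C X → Subsingleton (Abelian.Ext.{u} M X 1)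

/-- `M` is split-projective in `C`: `M` lies in `C` and every surjection onto `M` from a module
in `C` splits. -/
def IsSplitProjective (C : ObjectProperty (ModuleCat.{u} A)) (M : ModuleCat.{u} A) : Prop :=
  C M ∧ ∀ (X : ModuleCat.{u} A), C X → ∀ α : X ⟶ M, Function.Surjective α.hom →
    ∃ s : M ⟶ X, s ≫ α = 𝟙 M

/-- A projective cover: a domain minimal surjection from a finitely generated projective. -/
structure IsProjectiveCover {P M : ModuleCat.{u} A} (p : P ⟶ M) : Prop where
  finite : Module.Finite A P
  projective : Module.Projective A P
  surjective : Function.Surjective p.hom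
  minimal : IsDomainMinimal p

/-- A minimal projective presentation `P₁ ⟶ P₀ ⟶ M ⟶ 0`: `p : P₀ ⟶ M` is a projective cover of
`M`, and `q : P₁ ⟶ ker p` is a projective cover of the kernel of `p`. -/
structure MinimalProjectivePresentation (M : ModuleCat.{u} A) where
  P₀ : ModuleCat.{u} A
  p : P₀ ⟶ M
  isCover_p : IsProjectiveCover p
  P₁ : ModuleCat.{u} A
  q : P₁ ⟶ ModuleCat.of A (LinearMap.ker p.hom)
  isCover_q : IsProjectiveCover q

/-- The map `P₁ → P₀` of a minimal projective presentation. -/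
def MinimalProjectivePresentation.d {M : ModuleCat.{u} A} (P : MinimalProjectivePresentation M) :
    P.P₁ →ₗ[A] P.P₀ :=
  (LinearMap.ker P.p.hom).subtype ∘ₗ P.q.hom

end ModuleClasses

section Translate

variable (K : Type u) {A : Type u} [Field K] [Ring A] [Algebra K A]

/-- The underlying space of `ν P = D Hom_A(P, A)`, where `D = Hom_K(-, K)`. -/
def Nakayama (P : Type u) [AddCommGroup P] [Module A P] : Type u :=
  Module.Dual K (P →ₗ[A] A)

namespace Nakayama

variable (P : Type u) [AddCommGroup P] [Module A P]

instance : AddCommGroup (Nakayama K (A := A) P) :=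
  inferInstanceAs (AddCommGroup (Module.Dual K (P →ₗ[A] A)))

/-- The right action of `a : A` on `Hom_A(P, A)`: the map `g` goes to `x ↦ g x * a`. -/
def rightMul (a : A) : (P →ₗ[A] A) →ₗ[K] (P →ₗ[A] A) where
  toFun g := LinearMap.toSpanSingleton A A a ∘ₗ g
  map_add' g h := by ext x; simp [add_mul]
  map_smul' c g := by ext x; simp

theorem rightMul_one : rightMul K P (1 : A) = LinearMap.id := by
  ext g x; simp [rightMul]

theorem rightMul_mul (a b : A) :
    rightMul K P (a * b) = rightMul K P b ∘ₗ rightMul K P a := by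
  ext g x; simp [rightMul, mul_assoc]

theorem rightMul_add (a b : A) : rightMul K P (a + b) = rightMul K P a + rightMul K P b := by
  ext g x; simp [rightMul, mul_add]

theorem rightMul_zero : rightMul K P (0 : A) = 0 := by
  ext g x; simp [rightMul]

/-- The left `A`-module structure on `ν P`: `(a • φ) g = φ (g · a)`. -/
instance : Module A (Nakayama K (A := A) P) where
  smul a φ := LinearMap.comp (φ : Module.Dual K (P →ₗ[A] A)) (rightMul K P a)
  one_smul φ := (congrArg (LinearMap.comp (φ : Module.Dual K (P →ₗ[A] A)))
    (rightMul_one K P)).trans (LinearMap.comp_id _)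
  mul_smul a b φ := congrArg (LinearMap.comp (φ : Module.Dual K (P →ₗ[A] A)))
    (rightMul_mul K P a b)
  smul_zero a := LinearMap.zero_comp (rightMul K P a)
  smul_add a φ ψ := LinearMap.add_comp (rightMul K P a) (ψ : Module.Dual K (P →ₗ[A] A))
    (φ : Module.Dual K (P →ₗ[A] A))
  add_smul a b φ := (congrArg (LinearMap.comp (φ : Module.Dual K (P →ₗ[A] A)))
    (rightMul_add K P a b)).trans (LinearMap.comp_add _ _ _)
  zero_smul φ := (congrArg (LinearMap.comp (φ : Module.Dual K (P →ₗ[A] A)))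
    (rightMul_zero K P)).trans (LinearMap.comp_zero _)

variable {P} {Q : Type u} [AddCommGroup Q] [Module A Q]

/-- Precomposition `Hom_A(Q, A) → Hom_A(P, A)` with `d : P → Q`. -/
def precomp (d : P →ₗ[A] Q) : (Q →ₗ[A] A) →ₗ[K] (P →ₗ[A] A) where
  toFun g := g ∘ₗ d
  map_add' _ _ := rfl
  map_smul' _ _ := rfl

/-- The functor `ν = D Hom_A(-, A)` on maps. -/
def map (d : P →ₗ[A] Q) : Nakayama K (A := A) P →ₗ[A] Nakayama K (A := A) Q where
  toFun φ := LinearMap.comp (φ : Module.Dual K (P →ₗ[A] A)) (precomp K d)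
  map_add' _ _ := rfl
  map_smul' _ _ := rfl

end Nakayama

/-- The Auslander-Reiten translate `τ M = D Tr M = ker (ν P₁ → ν P₀)`, computed from a minimal
projective presentation `P₁ → P₀ → M → 0`. Minimal presentations of `M` exist (shown below for
every finite-dimensional `M`) and are unique up to isomorphism, hence so is `τ M`. -/
def MinimalProjectivePresentation.tau {M : ModuleCat.{u} A} (P : MinimalProjectivePresentation M) :
    ModuleCat.{u} A :=
  ModuleCat.of A (LinearMap.ker (Nakayama.map K P.d))

/-- `M` is `τ`-rigid: `M` is finite-dimensional and `Hom_A(M, τ M) = 0`, whichever minimal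
projective presentation is used to compute `τ M`. -/
def IsTauRigid (M : ModuleCat.{u} A) : Prop :=
  Module.Finite A M ∧ ∀ (P : MinimalProjectivePresentation M) (g : M ⟶ P.tau K), g = 0

end Translate

section Existence

variable {A : Type u} [Ring A] [IsNoetherianRing A] [IsArtinianRing A]

theorem exists_isProjectiveCover (M : ModuleCat.{u} A) [Module.Finite A M] :
    ∃ (P : ModuleCat.{u} A) (p : P ⟶ M), IsProjectiveCover p := by
  classical
  let S : Set ℕ∞ := {l | ∃ (P : ModuleCat.{u} A) (p : P ⟶ M), Module.Finite A P ∧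
    Module.Projective A P ∧ Function.Surjective p.hom ∧ Module.length A P = l}
  have hS : S.Nonempty := by
    obtain ⟨n, g, hg⟩ := Module.Finite.exists_fin' A M
    exact ⟨_, ModuleCat.of A (Fin n → A), ModuleCat.ofHom g, inferInstanceAs
      (Module.Finite A (Fin n → A)), inferInstanceAs (Module.Projective A (Fin n → A)), hg, rfl⟩
  obtain ⟨P, p, hfin, hproj, hsurj, hlen⟩ := WellFounded.min_mem wellFounded_lt S hS
  refine ⟨P, p, hfin, hproj, hsurj, fun β hβ => ?_⟩
  have hpow : ∀ n x, p.hom ((β.hom ^ n) x) = p.hom x := by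
    intro n
    induction n with
    | zero => intro x; simp
    | succ k ih =>
      intro x
      rw [pow_succ, Module.End.mul_apply, ih]
      exact congrArg (fun h => h.hom x) hβ
  obtain ⟨n, hn, hc⟩ := ((Filter.eventually_ge_atTop 1).and
    (LinearMap.eventually_isCompl_ker_pow_range_pow β.hom)).exists
  have hproj' : Module.Projective A (LinearMap.range (β.hom ^ n)) := by
    refine Module.Projective.of_split (Submodule.subtype _)
      (Submodule.projectionOnto _ _ hc.symm) ?_
    ext x
    exact congrArg Subtype.val (Submodule.projectionOnto_apply_left hc.symm x)
  have hrange : LinearMap.range (β.hom ^ n) = ⊤ := by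
    by_contra hne
    have hlt := Submodule.length_lt hne
    refine WellFounded.not_lt_min wellFounded_lt S
      (x := Module.length A (LinearMap.range (β.hom ^ n))) ⟨ModuleCat.of A
        (LinearMap.range (β.hom ^ n)), ModuleCat.ofHom (p.hom ∘ₗ Submodule.subtype _),
        inferInstanceAs (Module.Finite A (LinearMap.range (β.hom ^ n))), hproj', ?_, rfl⟩ ?_
    · intro m
      obtain ⟨x, rfl⟩ := hsurj m
      exact ⟨⟨(β.hom ^ n) x, x, rfl⟩, hpow n x⟩
    · rw [← hlen]; exact hlt
  have hs : Function.Surjective β.hom := by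
    intro y
    obtain ⟨x, hx⟩ := LinearMap.range_eq_top.1 hrange y
    obtain ⟨k, rfl⟩ := Nat.exists_eq_add_of_le' hn
    rw [pow_succ'] at hx
    exact ⟨_, hx⟩
  have hi : Function.Injective β.hom :=
    IsNoetherian.injective_of_surjective_endomorphism β.hom hs
  exact (ConcreteCategory.isIso_iff_bijective β).2 ⟨hi, hs⟩

/-- Over an Artinian ring, finitely generated modules have minimal projective presentations. -/
theorem nonempty_minimalProjectivePresentation (M : ModuleCat.{u} A) [Module.Finite A M] :
    Nonempty (MinimalProjectivePresentation M) := by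
  obtain ⟨P₀, p, hp⟩ := exists_isProjectiveCover M
  have := hp.finite
  have : Module.Finite A (ModuleCat.of A (LinearMap.ker p.hom)) :=
    inferInstanceAs (Module.Finite A (LinearMap.ker p.hom))
  obtain ⟨P₁, q, hq⟩ := exists_isProjectiveCover (ModuleCat.of A (LinearMap.ker p.hom))
  exact ⟨⟨P₀, p, hp, P₁, q, hq⟩⟩

end Existence

/-!
A torsion class `𝒯` is the left perpendicular of its torsion-free class, so it is closed under
quotients and extensions. Maps `A → X` with `X ∈ 𝒯` factor through the envelope `f : A → T`, so
`T` generates `𝒯`. Minimality of `f` makes `T` split-projective (`IsEnvelope.isSplitProjective`).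

Since `𝒯` is closed under extensions, split-projectives are Ext-projective
(`IsTorsionTheory.isExtProjective_of_isSplitProjective`). For `C = coker f`, lift `T → C` to an
extension of `C` by a module in `𝒯` and correct the lift on the image of `f`, using the factoring
property of `f` again (`IsEnvelope.isExtProjective_coker`).

An Ext-projective `M` in `𝒯` is `τ`-rigid. Let `P₁ → P₀ → M` be a minimal presentation. A nonzero
map `M → τ M = ker (ν P₁ → ν P₀)` yields a map `P₁ → M` that does not factor through `P₀`
(`Nakayama.eq_zero_of_forall_factor`). But every map `P₁ → M` does factor, by Ext-projectivity
applied to quotients of `M`, minimality of the presentation and induction on the image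
(`IsExtProjective.exists_factor_d`).

For `X ∈ 𝒯`, a power `W` of `T' = T ⊕ C` has a map to `X` through which all maps `T' → X` factor.
It is surjective, and its kernel is generated by `T`: a map from `A` to the kernel extends to `T →
W`, and the failure of this extension to land in the kernel is a map `C → X`, which lifts to `W`
(`IsEnvelope.exists_map_to_ker`). If `X` is Ext-projective, the surjection `W → X` splits, whence
`X ∈ add T'`.
-/

/-! ### Vanishing of `Ext¹` and splitting of extensions -/

section ExtVanishing

variable {A : Type u} [Ring A]

theorem shortExact_of_linearMap {X E M : ModuleCat.{u} A} (ι : X →ₗ[A] E) (α : E →ₗ[A] M)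
    (hι : Function.Injective ι) (hια : Function.Exact ι α) (hα : Function.Surjective α) :
    (ShortComplex.mk (ModuleCat.ofHom ι) (ModuleCat.ofHom α)
      (ModuleCat.hom_ext hια.linearMap_comp_eq_zero)).ShortExact where
  exact := (ShortComplex.ShortExact.moduleCat_exact_iff_function_exact _).2 hια
  mono_f := (ModuleCat.mono_iff_injective _).2 hι
  epi_g := (ModuleCat.epi_iff_surjective _).2 hα

theorem exists_extension_of_subsingleton_ext {M X E : ModuleCat.{u} A}
    (hExt : Subsingleton (Abelian.Ext.{u} M X 1)) (α : E →ₗ[A] M)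
    (hα : Function.Surjective α) (g : LinearMap.ker α →ₗ[A] X) :
    ∃ h : E →ₗ[A] X, ∀ x : LinearMap.ker α, h x = g x := by
  have hS := shortExact_of_linearMap (X := ModuleCat.of A (LinearMap.ker α))
    (LinearMap.ker α).subtype α Subtype.val_injective (LinearMap.exact_subtype_ker_map α) hα
  obtain ⟨e, he⟩ := Abelian.Ext.contravariant_sequence_exact₁ hS X
    (Abelian.Ext.mk₀ (ModuleCat.ofHom g)) (add_zero 1) (Subsingleton.elim _ _)
  obtain ⟨h, rfl⟩ := Abelian.Ext.addEquiv₀.symm.surjective e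
  have key : ModuleCat.ofHom (LinearMap.ker α).subtype ≫ h = ModuleCat.ofHom g := by
    apply Abelian.Ext.addEquiv₀.symm.injective
    simpa using he
  exact ⟨h.hom, fun x => congrArg (fun k => k.hom x) key⟩

theorem exists_lift_of_subsingleton_ext {M X E Y : ModuleCat.{u} A}
    (hExt : Subsingleton (Abelian.Ext.{u} M X 1)) (ι : X →ₗ[A] E) (α : E →ₗ[A] Y)
    (hι : Function.Injective ι) (hια : Function.Exact ι α) (hα : Function.Surjective α)
    (g : M →ₗ[A] Y) : ∃ s : M →ₗ[A] E, ∀ m, α (s m) = g m := by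
  have hS := shortExact_of_linearMap ι α hι hια hα
  obtain ⟨e, he⟩ := Abelian.Ext.covariant_sequence_exact₃ M hS
    (Abelian.Ext.mk₀ (ModuleCat.ofHom g)) (zero_add 1) (Subsingleton.elim _ _)
  obtain ⟨h, rfl⟩ := Abelian.Ext.addEquiv₀.symm.surjective e
  have key : h ≫ ModuleCat.ofHom α = ModuleCat.ofHom g := by
    apply Abelian.Ext.addEquiv₀.symm.injective
    simpa using he
  exact ⟨h.hom, fun x => congrArg (fun k => k.hom x) key⟩

/-- If every extension of `M` by `X` splits, then `Ext¹(M, X) = 0`: an extension class comes from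
a map `Ω → X` on the kernel `Ω` of a projective presentation `P → M`, and a splitting of the
pushout extension extends that map to `P`. -/
theorem subsingleton_ext_of_splits {M X : ModuleCat.{u} A}
    (hsplit : ∀ (E : ModuleCat.{u} A) (ι : X →ₗ[A] E) (α : E →ₗ[A] M), Function.Injective ι →
      Function.Exact ι α → Function.Surjective α → ∃ s : M →ₗ[A] E, ∀ m, α (s m) = m) :
    Subsingleton (Abelian.Ext.{u} M X 1) := by
  obtain ⟨P, π, hP, hπ⟩ : ∃ (P : ModuleCat.{u} A) (π : P →ₗ[A] M),
      Projective P ∧ Function.Surjective π :=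
    ⟨Projective.over M, (Projective.π M).hom, inferInstance,
      (ModuleCat.epi_iff_surjective _).1 inferInstance⟩
  have hS := shortExact_of_linearMap (X := ModuleCat.of A (LinearMap.ker π))
    (LinearMap.ker π).subtype π Subtype.val_injective (LinearMap.exact_subtype_ker_map π) hπ
  refine subsingleton_of_forall_eq 0 fun e => ?_
  obtain ⟨g', rfl⟩ := Abelian.Ext.contravariant_sequence_exact₃ hS X e
    (Abelian.Ext.eq_zero_of_projective (P := P) _) (add_zero 1)
  obtain ⟨g, rfl⟩ := Abelian.Ext.addEquiv₀.symm.surjective g'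
  let γ : LinearMap.ker π →ₗ[A] X := g.hom
  -- `(X × P) ⧸ N` is the pushout of `P` and `X` over `ker π`.
  let N : Submodule A (X × P) := LinearMap.range (γ.prod (-(LinearMap.ker π).subtype))
  let ι : X →ₗ[A] (X × P) ⧸ N := N.mkQ ∘ₗ LinearMap.inl A X P
  let α : ((X × P) ⧸ N) →ₗ[A] M := N.liftQ (π ∘ₗ LinearMap.snd A X P) (by
    rintro _ ⟨w, rfl⟩
    simp)
  have hι : Function.Injective ι := by
    rw [injective_iff_map_eq_zero]
    intro x hx
    obtain ⟨w, hw⟩ := (Submodule.Quotient.mk_eq_zero N).1 hx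
    have h2 : w = 0 := by
      have := congrArg Prod.snd hw
      simpa using this
    have h1 := congrArg Prod.fst hw
    rw [h2] at h1
    simpa using h1.symm
  have hια : Function.Exact ι α := by
    intro y
    constructor
    · induction y using Submodule.Quotient.induction_on with
      | _ y =>
      obtain ⟨x, p⟩ := y
      intro hy
      have hp : π p = 0 := hy
      refine ⟨x + γ ⟨p, hp⟩, (Submodule.Quotient.eq N).2 ⟨⟨p, hp⟩, ?_⟩⟩
      simp
    · rintro ⟨x, rfl⟩
      change π 0 = 0
      exact map_zero π
  have hαs : Function.Surjective α := fun m => by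
    obtain ⟨p, rfl⟩ := hπ m
    exact ⟨N.mkQ (0, p), rfl⟩
  obtain ⟨s, hs⟩ := hsplit (ModuleCat.of A _) ι α hι hια hαs
  -- `P → (X × P) ⧸ N` minus the splitting takes values in the copy of `X`.
  let δ : P →ₗ[A] ((X × P) ⧸ N) := N.mkQ ∘ₗ LinearMap.inr A X P - s ∘ₗ π
  have hδ : ∀ p, δ p ∈ LinearMap.range ι := fun p => by
    refine (hια _).1 ?_
    change α (N.mkQ (0, p) - s (π p)) = 0
    rw [map_sub, hs]
    exact sub_self _
  let h : P →ₗ[A] X :=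
    (LinearEquiv.ofInjective ι hι).symm.toLinearMap ∘ₗ δ.codRestrict (LinearMap.range ι) hδ
  have hh : ∀ p, ι (h p) = δ p := fun p =>
    congrArg Subtype.val ((LinearEquiv.ofInjective ι hι).apply_symm_apply
      (δ.codRestrict (LinearMap.range ι) hδ p))
  have key : g = ModuleCat.ofHom (LinearMap.ker π).subtype ≫ ModuleCat.ofHom h := by
    refine ModuleCat.hom_ext (LinearMap.ext fun w => hι ?_)
    change ι (γ w) = ι (h w)
    rw [hh]
    change N.mkQ (γ w, 0) = N.mkQ (0, (w : P)) - s (π w)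
    rw [show π w = 0 from w.2, map_zero, sub_zero]
    refine (Submodule.Quotient.eq N).2 ⟨w, ?_⟩
    simp
  rw [key, Abelian.Ext.addEquiv₀_symm_apply, ← Abelian.Ext.mk₀_comp_mk₀,
    hS.extClass_comp_assoc]

end ExtVanishing

/-! ### Module classes and torsion classes -/

section ModuleClassLemmas

variable {A : Type u} [Ring A]

theorem exists_factor_of_ker_le {E Y F : Type*} [AddCommGroup E] [Module A E] [AddCommGroup Y]
    [Module A Y] [AddCommGroup F] [Module A F] (p : E →ₗ[A] Y) (hp : Function.Surjective p)
    (g : E →ₗ[A] F) (h : LinearMap.ker p ≤ LinearMap.ker g) :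
    ∃ g' : Y →ₗ[A] F, ∀ e, g' (p e) = g e := by
  refine ⟨(LinearMap.ker p).liftQ g h ∘ₗ (p.quotKerEquivOfSurjective hp).symm.toLinearMap,
    fun e => ?_⟩
  have : (p.quotKerEquivOfSurjective hp).symm (p e) = (LinearMap.ker p).mkQ e := by
    rw [LinearEquiv.symm_apply_eq]; rfl
  simp only [LinearMap.comp_apply, LinearEquiv.coe_coe, this]
  simp

theorem IsModuleClass.of_equiv {C : ObjectProperty (ModuleCat.{u} A)} (hC : IsModuleClass C)
    {X Y : Type u} [AddCommGroup X] [Module A X] [AddCommGroup Y] [Module A Y]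
    (e : X ≃ₗ[A] Y) (hX : C (ModuleCat.of A X)) : C (ModuleCat.of A Y) :=
  hC.iso _ _ ⟨e.toModuleIso⟩ hX

theorem IsModuleClass.of_retract {C : ObjectProperty (ModuleCat.{u} A)} (hC : IsModuleClass C)
    {X Y : ModuleCat.{u} A} (hX : C X) (s : Y →ₗ[A] X) (r : X →ₗ[A] Y)
    (h : ∀ y, r (s y) = y) : C Y := by
  let e : X ≃ₗ[A] (Y × LinearMap.ker r) :=
    { toFun x := (r x, ⟨x - s (r x), by simp [h]⟩)
      map_add' x y := by ext <;> simp; abel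
      map_smul' c x := by ext <;> simp [smul_sub]
      invFun z := s z.1 + z.2
      left_inv x := by simp
      right_inv z := by
        have hz : r (z.2 : X) = 0 := z.2.2
        ext <;> simp [h, hz] }
  exact ((hC.sum Y (ModuleCat.of A (LinearMap.ker r))).2 (hC.of_equiv e hX)).1

theorem IsModuleClass.fin_pi {C : ObjectProperty (ModuleCat.{u} A)} (hC : IsModuleClass C)
    {X : ModuleCat.{u} A} (hX : C X) (n : ℕ) : C (ModuleCat.of A (Fin n → X)) := by
  induction n with
  | zero => exact hC.of_retract hX 0 0 fun y => Subsingleton.elim _ _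
  | succ n ih =>
    exact hC.of_equiv (Fin.consLinearEquiv A fun _ : Fin (n + 1) => X)
      ((hC.sum X (ModuleCat.of A (Fin n → X))).1 ⟨hX, ih⟩)

theorem isModuleClass_finite :
    IsModuleClass fun X : ModuleCat.{u} A => Module.Finite A X where
  finite _ h := h
  iso _ _ := fun ⟨e⟩ _ => Module.Finite.equiv e.toLinearEquiv
  sum X Y := ⟨fun ⟨_, _⟩ => inferInstanceAs (Module.Finite A (X × Y)), fun h =>
    have : Module.Finite A (X × Y) := h
    ⟨Module.Finite.of_surjective (LinearMap.fst A X Y) LinearMap.fst_surjective,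
      Module.Finite.of_surjective (LinearMap.snd A X Y) LinearMap.snd_surjective⟩⟩

theorem isModuleClass_addClass (X : ModuleCat.{u} A) [hX : Module.Finite A X] :
    IsModuleClass (addClass X) where
  finite _ h := h _ isModuleClass_finite hX
  iso Y Z e hY C hC hCX := hC.iso Y Z e (hY C hC hCX)
  sum Y Z := ⟨fun h C hC hCX => (hC.sum Y Z).1 ⟨h.1 C hC hCX, h.2 C hC hCX⟩, fun h =>
    ⟨fun C hC hCX => ((hC.sum Y Z).2 (h C hC hCX)).1,
      fun C hC hCX => ((hC.sum Y Z).2 (h C hC hCX)).2⟩⟩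

theorem addClass_self (X : ModuleCat.{u} A) : addClass X X := fun _ _ h => h

/-- The torsion class of a torsion theory is the left perpendicular of the torsion-free class. -/
theorem IsTorsionTheory.mem_of_hom_eq_zero {𝒯 ℱ : ObjectProperty (ModuleCat.{u} A)}
    (h : IsTorsionTheory 𝒯 ℱ) (X : ModuleCat.{u} A) [Module.Finite A X]
    (hX : ∀ Y : ModuleCat.{u} A, ℱ Y → ∀ g : X →ₗ[A] Y, g = 0) : 𝒯 X := by
  obtain ⟨t, ht, ht'⟩ := h.exists_sequence X inferInstance
  have htop : t = ⊤ := by rw [← t.ker_mkQ, hX _ ht' t.mkQ, LinearMap.ker_zero]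
  subst htop
  exact h.torsion.of_equiv Submodule.topEquiv ht

theorem IsTorsionTheory.mem_of_surjective {𝒯 ℱ : ObjectProperty (ModuleCat.{u} A)}
    (h : IsTorsionTheory 𝒯 ℱ) {X Y : ModuleCat.{u} A} (hX : 𝒯 X) (p : X →ₗ[A] Y)
    (hp : Function.Surjective p) : 𝒯 Y := by
  have := h.torsion.finite X hX
  have := Module.Finite.of_surjective p hp
  refine h.mem_of_hom_eq_zero Y fun F hF g => ?_
  ext y
  obtain ⟨x, rfl⟩ := hp y
  exact congrArg (fun k => k.hom x) (h.hom_eq_zero X F hX hF (ModuleCat.ofHom (g ∘ₗ p)))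

theorem IsTorsionTheory.mem_of_exact {𝒯 ℱ : ObjectProperty (ModuleCat.{u} A)}
    (h : IsTorsionTheory 𝒯 ℱ) {X E Y : ModuleCat.{u} A} (hX : 𝒯 X) (hY : 𝒯 Y)
    (i : X →ₗ[A] E) (p : E →ₗ[A] Y) (hip : Function.Exact i p)
    (hp : Function.Surjective p) : 𝒯 E := by
  have := h.torsion.finite X hX
  have := h.torsion.finite Y hY
  have : Module.Finite A E := by
    have : Module.Finite A (LinearMap.ker p) := by
      rw [hip.linearMap_ker_eq]
      infer_instance
    have : Module.Finite A (E ⧸ LinearMap.ker p) :=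
      Module.Finite.equiv (p.quotKerEquivOfSurjective hp).symm
    exact Module.Finite.of_submodule_quotient (LinearMap.ker p)
  refine h.mem_of_hom_eq_zero E fun F hF g => ?_
  have hgi : ∀ x, g (i x) = 0 := fun x =>
    congrArg (fun k => k.hom x) (h.hom_eq_zero X F hX hF (ModuleCat.ofHom (g ∘ₗ i)))
  have hle : LinearMap.ker p ≤ LinearMap.ker g := by
    intro e he
    obtain ⟨x, rfl⟩ := (hip e).1 he
    exact hgi x
  obtain ⟨g', hg'⟩ := exists_factor_of_ker_le p hp g hle
  have hzero : g' = 0 :=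
    congrArg ModuleCat.Hom.hom (h.hom_eq_zero Y F hY hF (ModuleCat.ofHom g'))
  ext e
  rw [← hg', hzero]
  rfl

end ModuleClassLemmas

/-! ### The envelope of `A`: generation and Ext-projectivity -/

section Generation

variable {A : Type u} [Ring A]

/-- Maps `A → X` to `𝒯`-modules factor through the envelope, so each element of `X` is hit by a
map `T → X`. -/
theorem IsEnvelope.exists_map_apply_eq {𝒯 : ObjectProperty (ModuleCat.{u} A)}
    {T : ModuleCat.{u} A} {f : ModuleCat.of A A ⟶ T} (hf : IsEnvelope 𝒯 f)
    {X : ModuleCat.{u} A} (hX : 𝒯 X) (x : X) :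
    ∃ g : T →ₗ[A] X, ∀ a : A, g (f.hom a) = a • x := by
  obtain ⟨g, hg⟩ := hf.factors X hX (ModuleCat.ofHom (LinearMap.toSpanSingleton A X x))
  exact ⟨g.hom, fun a => congrArg (fun k => k.hom a) hg⟩

/-- A finitely generated module whose elements are all hit by maps from `M` is a quotient of a
finite power of `M`. -/
theorem exists_surjective_fin_pi {M X : ModuleCat.{u} A} [Module.Finite A X]
    (h : ∀ x : X, ∃ (g : M →ₗ[A] X) (m : M), g m = x) :
    ∃ (n : ℕ) (p : (Fin n → M) →ₗ[A] X), Function.Surjective p := by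
  obtain ⟨n, v, hv⟩ := Module.Finite.exists_fin (R := A) (M := X)
  choose g m hgm using fun i => h (v i)
  let p : (Fin n → M) →ₗ[A] X := ∑ i, g i ∘ₗ LinearMap.proj i
  refine ⟨n, p, ?_⟩
  rw [← LinearMap.range_eq_top, eq_top_iff, ← hv, Submodule.span_le]
  rintro _ ⟨i, rfl⟩
  refine ⟨Pi.single i (m i), ?_⟩
  rw [LinearMap.sum_apply, Finset.sum_eq_single i]
  · simp [hgm]
  · intro j _ hj
    simp [hj]
  · simp

theorem genClass_of_forall_exists_map {M X : ModuleCat.{u} A} [Module.Finite A M]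
    [Module.Finite A X] (h : ∀ x : X, ∃ (g : M →ₗ[A] X) (m : M), g m = x) : genClass M X := by
  obtain ⟨n, p, hp⟩ := exists_surjective_fin_pi h
  exact ⟨_, ModuleCat.ofHom p, (isModuleClass_addClass M).fin_pi (addClass_self M) n, hp⟩

theorem IsTorsionTheory.mem_of_genClass {𝒯 ℱ : ObjectProperty (ModuleCat.{u} A)}
    (h : IsTorsionTheory 𝒯 ℱ) {M X : ModuleCat.{u} A} (hM : 𝒯 M) (hX : genClass M X) : 𝒯 X := by
  obtain ⟨W, p, hW, hp⟩ := hX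
  exact h.mem_of_surjective (hW 𝒯 h.torsion hM) p.hom hp

theorem IsTorsionTheory.eq_genClass {𝒯 ℱ : ObjectProperty (ModuleCat.{u} A)}
    (h : IsTorsionTheory 𝒯 ℱ) {M : ModuleCat.{u} A} (hM : 𝒯 M)
    (hgen : ∀ X : ModuleCat.{u} A, 𝒯 X → ∀ x : X, ∃ (g : M →ₗ[A] X) (m : M), g m = x) :
    𝒯 = genClass M := by
  have := h.torsion.finite M hM
  ext X
  refine ⟨fun hX => ?_, h.mem_of_genClass hM⟩
  have := h.torsion.finite X hX
  exact genClass_of_forall_exists_map (hgen X hX)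

/-- A surjection from an object of `𝒯` onto the envelope of `A` splits: lift `f` along it by
projectivity of `A`, factor the lift through `f`, and use minimality of `f`. -/
theorem IsEnvelope.isSplitProjective {𝒯 : ObjectProperty (ModuleCat.{u} A)}
    {T : ModuleCat.{u} A} {f : ModuleCat.of A A ⟶ T} (hf : IsEnvelope 𝒯 f) :
    IsSplitProjective 𝒯 T := by
  refine ⟨hf.mem, fun X hX α hα => ?_⟩
  obtain ⟨x, hx⟩ := hα (f.hom (1 : A))
  obtain ⟨g, hg⟩ := hf.exists_map_apply_eq hX x
  have := hf.minimal (ModuleCat.ofHom g ≫ α) (by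
    ext
    change α.hom (g (f.hom (1 : A))) = f.hom (1 : A)
    rw [hg, one_smul, hx])
  exact ⟨inv (ModuleCat.ofHom g ≫ α) ≫ ModuleCat.ofHom g, by
    rw [Category.assoc, IsIso.inv_hom_id]⟩

theorem IsTorsionTheory.isExtProjective_of_isSplitProjective
    {𝒯 ℱ : ObjectProperty (ModuleCat.{u} A)} (h : IsTorsionTheory 𝒯 ℱ) {M : ModuleCat.{u} A}
    (hM : IsSplitProjective 𝒯 M) : IsExtProjective 𝒯 M := by
  refine ⟨hM.1, fun X hX => subsingleton_ext_of_splits fun E ι α _ hια hα => ?_⟩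
  obtain ⟨s, hs⟩ := hM.2 E (h.mem_of_exact hX hM.1 ι α hια hα) (ModuleCat.ofHom α) hα
  exact ⟨s.hom, fun m => congrArg (fun k => k.hom m) hs⟩

theorem IsExtProjective.prod {𝒯 : ObjectProperty (ModuleCat.{u} A)} (h𝒯 : IsModuleClass 𝒯)
    {M N : ModuleCat.{u} A} (hM : IsExtProjective 𝒯 M) (hN : IsExtProjective 𝒯 N) :
    IsExtProjective 𝒯 (ModuleCat.of A (M × N)) := by
  refine ⟨(h𝒯.sum M N).1 ⟨hM.1, hN.1⟩, fun X hX =>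
    subsingleton_ext_of_splits fun E ι α hι hια hα => ?_⟩
  obtain ⟨s, hs⟩ := exists_lift_of_subsingleton_ext (hM.2 X hX) ι α hι hια hα
    (LinearMap.inl A M N)
  obtain ⟨t, ht⟩ := exists_lift_of_subsingleton_ext (hN.2 X hX) ι α hι hια hα
    (LinearMap.inr A M N)
  exact ⟨s.coprod t, fun m => by rw [LinearMap.coprod_apply, map_add, hs, ht]; simp⟩

/-- The cokernel `C` of the envelope `f : A → T` is Ext-projective: given an extension of `C` by
`X ∈ 𝒯`, the projection `T → C` lifts to it; the restriction of the lift to `A` lands in `X`, so it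
extends along `f`, and subtracting that extension makes the lift vanish on the image of `f`. -/
theorem IsEnvelope.isExtProjective_coker {𝒯 : ObjectProperty (ModuleCat.{u} A)}
    {T : ModuleCat.{u} A} {f : ModuleCat.of A A ⟶ T} (hf : IsEnvelope 𝒯 f)
    (hT : IsExtProjective 𝒯 T)
    (hC : 𝒯 (ModuleCat.of A (T ⧸ LinearMap.range f.hom))) :
    IsExtProjective 𝒯 (ModuleCat.of A (T ⧸ LinearMap.range f.hom)) := by
  refine ⟨hC, fun X hX => subsingleton_ext_of_splits fun E ι α hι hια hα => ?_⟩
  let R := LinearMap.range f.hom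
  obtain ⟨s, hs⟩ := exists_lift_of_subsingleton_ext (hT.2 X hX) ι α hι hια hα R.mkQ
  obtain ⟨x, hx⟩ := (hια (s (f.hom (1 : A)))).1 (by
    rw [hs]
    exact (Submodule.Quotient.mk_eq_zero R).2 ⟨1, rfl⟩)
  obtain ⟨r, hr⟩ := hf.exists_map_apply_eq hX x
  have hle : R ≤ LinearMap.ker (s - ι ∘ₗ r) := by
    rintro _ ⟨a, rfl⟩
    have ha : f.hom a = a • f.hom (1 : A) := by
      rw [← map_smul, smul_eq_mul, mul_one]
    rw [LinearMap.mem_ker, LinearMap.sub_apply, LinearMap.comp_apply, hr, ha, map_smul, map_smul,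
      hx, sub_self]
  refine ⟨R.liftQ _ hle, fun m => ?_⟩
  obtain ⟨t, rfl⟩ := R.mkQ_surjective m
  have hιr : α (ι (r t)) = 0 := hια.apply_apply_eq_zero _
  change α (s t - ι (r t)) = R.mkQ t
  rw [map_sub, hs, hιr, sub_zero]

end Generation

/-! ### Right approximations -/

section Approximation

/-- Finitely many maps spanning `Hom_A(M, X)` over `K` form a right `add M`-approximation. -/
theorem exists_right_approximation (K : Type*) {A M X : Type*} [Field K] [Ring A] [Algebra K A]
    [FiniteDimensional K A] [AddCommGroup M] [Module A M] [AddCommGroup X] [Module A X]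
    [Module.Finite A M] [Module.Finite A X] :
    ∃ (n : ℕ) (φ : (Fin n → M) →ₗ[A] X), ∀ g : M →ₗ[A] X,
      ∃ s : M →ₗ[A] (Fin n → M), ∀ m, φ (s m) = g m := by
  let _ : Module K M := Module.restrictScalars K A M
  let _ : Module K X := Module.restrictScalars K A X
  have : IsScalarTower K A M := IsScalarTower.restrictScalars K A M
  have : IsScalarTower K A X := IsScalarTower.restrictScalars K A X
  have : FiniteDimensional K M := Module.Finite.trans A M
  have : FiniteDimensional K X := Module.Finite.trans A X
  let b := Module.finBasis K (M →ₗ[A] X)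
  refine ⟨_, ∑ i, b i ∘ₗ LinearMap.proj i, fun g =>
    ⟨LinearMap.pi fun i => b.repr g i • LinearMap.id, fun m => ?_⟩⟩
  have hg := LinearMap.congr_fun (b.sum_repr g) m
  rw [LinearMap.sum_apply] at hg
  refine Eq.trans ?_ hg
  simp [LinearMap.map_smul_of_tower]

/-- The kernel of a right approximation `φ : W → X` by copies of `T ⊕ C`, with `C` the cokernel of
the envelope `f : A → T`, is generated by `T`. For `x ∈ ker φ` the map `A → W`, `1 ↦ x`, factors
as `g ∘ f`; then `φ ∘ g` kills the image of `f`, hence comes from a map `C → X`, which lifts to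
`c : C → W`. Subtracting `c` from `g` gives a map `T → ker φ` hitting `x`. -/
theorem IsEnvelope.exists_map_to_ker {A : Type u} [Ring A] {𝒯 : ObjectProperty (ModuleCat.{u} A)}
    {T : ModuleCat.{u} A} {f : ModuleCat.of A A ⟶ T} (hf : IsEnvelope 𝒯 f)
    {W X : ModuleCat.{u} A} (hW : 𝒯 W) (φ : W →ₗ[A] X)
    (hφ : ∀ g : (T ⧸ LinearMap.range f.hom) →ₗ[A] X,
      ∃ s : (T ⧸ LinearMap.range f.hom) →ₗ[A] W, ∀ m, φ (s m) = g m)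
    (x : LinearMap.ker φ) : ∃ (g : T →ₗ[A] LinearMap.ker φ) (t : T), g t = x := by
  let R := LinearMap.range f.hom
  obtain ⟨g, hg⟩ := hf.exists_map_apply_eq hW (x : W)
  have hle : R ≤ LinearMap.ker (φ ∘ₗ g) := by
    rintro _ ⟨a, rfl⟩
    have hx : φ x = 0 := x.2
    rw [LinearMap.mem_ker, LinearMap.comp_apply, hg, map_smul, hx, smul_zero]
  obtain ⟨c, hc⟩ := hφ (R.liftQ _ hle)
  refine ⟨(g - c ∘ₗ R.mkQ).codRestrict (LinearMap.ker φ) fun t => ?_, f.hom (1 : A),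
    Subtype.ext ?_⟩
  · have : φ (c (R.mkQ t)) = φ (g t) := hc (R.mkQ t)
    rw [LinearMap.mem_ker, LinearMap.sub_apply, LinearMap.comp_apply, map_sub, this, sub_self]
  · have : R.mkQ (f.hom (1 : A)) = 0 := (Submodule.Quotient.mk_eq_zero R).2 ⟨1, rfl⟩
    have h1 := hg (1 : A)
    simp only [LinearMap.codRestrict_apply, LinearMap.sub_apply, LinearMap.comp_apply, this,
      map_zero, sub_zero, h1, one_smul]

end Approximation

/-! ### `τ`-rigidity of Ext-projective modules -/

section TauRigid

variable (K : Type u) {A : Type u} [Field K] [Ring A] [Algebra K A]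

theorem exists_dual_basis (P : Type*) [AddCommGroup P] [Module A P] [Module.Finite A P]
    [Module.Projective A P] : ∃ (n : ℕ) (e : Fin n → P) (e' : Fin n → P →ₗ[A] A),
      ∀ p, ∑ i, e' i p • e i = p := by
  obtain ⟨n, f, g, -, -, hfg⟩ := Module.Finite.exists_comp_eq_id_of_projective A P
  refine ⟨n, fun i => f (Pi.single i 1), fun i => LinearMap.proj i ∘ₗ g, fun p => ?_⟩
  conv_rhs => rw [← LinearMap.id_apply (R := A) p, ← hfg, LinearMap.comp_apply,
    pi_eq_sum_univ' (g p), map_sum]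
  simp

/-- The elements of `ν P`, regarded as linear functionals on `Hom_A(P, A)`. -/
def Nakayama.toDual {P : Type u} [AddCommGroup P] [Module A P] :
    Nakayama K (A := A) P →+ Module.Dual K (P →ₗ[A] A) :=
  AddMonoidHom.id (Module.Dual K (P →ₗ[A] A))

/-- A map `φ : X → ν P` is determined by the functional `g ↦ ∑ φ (g eᵢ) (eᵢ*)` on `Hom_A(P, X)`,
where `(eᵢ, eᵢ*)` is a dual basis of `P`; here `g` is the map `p ↦ l p • y`. -/
theorem Nakayama.sum_dual_basis {P X : Type u} [AddCommGroup P] [Module A P] [AddCommGroup X]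
    [Module A X] {n : ℕ} {e : Fin n → P} {e' : Fin n → P →ₗ[A] A}
    (he : ∀ p, ∑ i, e' i p • e i = p) (φ : X →ₗ[A] Nakayama K (A := A) P) (y : X)
    (l : P →ₗ[A] A) :
    ∑ i, toDual K (φ (l (e i) • y)) (e' i) = toDual K (φ y) l := by
  have h : ∀ i, toDual K (φ (l (e i) • y)) (e' i) =
      toDual K (φ y) (rightMul K P (l (e i)) (e' i)) := fun i => by
    rw [map_smul]; rfl
  have hl : l = ∑ i, rightMul K P (l (e i)) (e' i) := by
    ext p
    conv_lhs => rw [← he p]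
    simp [rightMul]
  rw [Finset.sum_congr rfl fun i _ => h i, ← map_sum, ← hl]

/-- If enough maps `P → X` factor through `d : P → Q`, no nonzero map `X → ν P` is killed by
`ν d`. This is the part of `Hom_A(X, ker ν d) ≅ D coker(Hom_A(Q, X) → Hom_A(P, X))` that
`τ`-rigidity requires. -/
theorem Nakayama.eq_zero_of_forall_factor {P Q X : Type u} [AddCommGroup P] [Module A P]
    [AddCommGroup Q] [Module A Q] [AddCommGroup X] [Module A X] [Module.Finite A P]
    [Module.Projective A P] [Module.Finite A Q] [Module.Projective A Q] (d : P →ₗ[A] Q)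
    (φ : X →ₗ[A] Nakayama K (A := A) P) (hφ : ∀ x, Nakayama.map K d (φ x) = 0)
    (hd : ∀ (x : X) (k : P →ₗ[A] A), ∃ h : Q →ₗ[A] X, ∀ p, h (d p) = k p • x) : φ = 0 := by
  obtain ⟨n, e, e', he⟩ := exists_dual_basis (A := A) P
  obtain ⟨m, c, c', hc⟩ := exists_dual_basis (A := A) Q
  refine LinearMap.ext fun x => LinearMap.ext fun k => ?_
  obtain ⟨h, hh⟩ := hd x k
  have hφ' : ∀ y (l : Q →ₗ[A] A), toDual K (φ y) (l ∘ₗ d) = 0 := fun y l =>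
    LinearMap.congr_fun (congrArg (toDual K) (hφ y)) l
  have hexp : ∀ i, k (e i) • x = ∑ j, (c' j ∘ₗ d) (e i) • h (c j) := fun i => by
    rw [← hh]
    conv_lhs => rw [← hc (d (e i))]
    simp
  change toDual K (φ x) k = 0
  rw [← Nakayama.sum_dual_basis K he]
  simp_rw [hexp, map_sum, LinearMap.sum_apply]
  rw [Finset.sum_comm]
  exact Finset.sum_eq_zero fun j _ => by rw [Nakayama.sum_dual_basis K he, hφ']

/-- The kernel of a projective cover is superfluous. -/
theorem IsProjectiveCover.eq_top_of_sup_ker_eq_top {A : Type u} [Ring A] {P M : ModuleCat.{u} A}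
    {p : P ⟶ M} (hp : IsProjectiveCover p) (N : Submodule A P)
    (hN : N ⊔ LinearMap.ker p.hom = ⊤) : N = ⊤ := by
  have := hp.projective
  have hs : Function.Surjective (p.hom ∘ₗ N.subtype) := fun m => by
    obtain ⟨x, rfl⟩ := hp.surjective m
    obtain ⟨y, hy, z, hz, rfl⟩ := Submodule.mem_sup.1 (hN ▸ Submodule.mem_top : x ∈ N ⊔ _)
    have hz' : p.hom z = 0 := hz
    exact ⟨⟨y, hy⟩, by simp [hz']⟩
  obtain ⟨β, hβ⟩ := Module.projective_lifting_property _ p.hom hs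
  have := hp.minimal (ModuleCat.ofHom (N.subtype ∘ₗ β)) (ModuleCat.hom_ext hβ)
  refine eq_top_iff.2 fun x _ => ?_
  obtain ⟨y, rfl⟩ :=
    ((ConcreteCategory.isIso_iff_bijective (ModuleCat.ofHom (N.subtype ∘ₗ β))).1 this).2 x
  exact (β y).2

/-- Every map `g : P₁ → M` factors through `d : P₁ → P₀`. Let `Z = ker d`. Since
`Ext¹(M, M / g Z) = 0`, the map `ker (P₀ → M) → M / g Z` induced by `g` extends to `P₀` and then
lifts to `h : P₀ → M`, so that `g - h d` takes values in `g Z`. As `Z` is superfluous, `g Z` is a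
proper submodule of `g P₁` unless `g = 0`, and induction on the image of `g` applies. -/
theorem IsExtProjective.exists_factor_d {A : Type u} [Ring A] [IsArtinianRing A]
    {𝒯 ℱ : ObjectProperty (ModuleCat.{u} A)} (h𝒯 : IsTorsionTheory 𝒯 ℱ) {M : ModuleCat.{u} A}
    (hM : IsExtProjective 𝒯 M) (P : MinimalProjectivePresentation M) (g : P.P₁ →ₗ[A] M) :
    ∃ h : P.P₀ →ₗ[A] M, ∀ x, h (P.d x) = g x := by
  have := h𝒯.torsion.finite M hM.1
  have := P.isCover_p.projective
  induction hI : LinearMap.range g using WellFoundedLT.induction generalizing g with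
  | _ I ih =>
  subst hI
  let Z : Submodule A P.P₁ := LinearMap.ker P.q.hom
  let G : Submodule A M := Z.map g
  -- If `g Z = g P₁`, then `Z + ker g = P₁`, so `g = 0` because `Z` is superfluous.
  by_cases hGI : G = LinearMap.range g
  · have htop : LinearMap.ker g = ⊤ := P.isCover_q.eq_top_of_sup_ker_eq_top _ (by
      refine eq_top_iff.2 fun x _ => ?_
      obtain ⟨z, hz, hzx⟩ : g x ∈ Z.map g := by
        change g x ∈ G
        rw [hGI]
        exact ⟨x, rfl⟩
      rw [← sub_add_cancel x z]
      exact Submodule.add_mem_sup (by simp [hzx]) hz)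
    refine ⟨0, fun x => ?_⟩
    have : x ∈ LinearMap.ker g := htop ▸ Submodule.mem_top
    exact (LinearMap.mem_ker.1 this).symm
  have hlt : G < LinearMap.range g := lt_of_le_of_ne (LinearMap.map_le_range) hGI
  obtain ⟨k, hk⟩ := exists_factor_of_ker_le P.q.hom P.isCover_q.surjective (G.mkQ ∘ₗ g)
    fun z hz => (Submodule.Quotient.mk_eq_zero G).2 ⟨z, hz, rfl⟩
  have hG : 𝒯 (ModuleCat.of A (M ⧸ G)) := h𝒯.mem_of_surjective hM.1 G.mkQ G.mkQ_surjective
  obtain ⟨k', hk'⟩ := exists_extension_of_subsingleton_ext (hM.2 _ hG) P.p.hom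
    P.isCover_p.surjective k
  obtain ⟨h, hh⟩ := Module.projective_lifting_property G.mkQ k' G.mkQ_surjective
  have hle : LinearMap.range (g - h ∘ₗ P.d) ≤ G := by
    rintro _ ⟨x, rfl⟩
    have h1 : G.mkQ (h (P.d x)) = k' (P.d x) := LinearMap.congr_fun hh (P.d x)
    have h2 : k' (P.d x) = k (P.q.hom x) := hk' (P.q.hom x)
    have h3 : k (P.q.hom x) = G.mkQ (g x) := hk x
    exact (Submodule.Quotient.eq G).1 (h1.trans (h2.trans h3)).symm
  obtain ⟨h', hh'⟩ := ih _ (hle.trans_lt hlt) (g - h ∘ₗ P.d) rfl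
  exact ⟨h' + h, fun x => by simp [hh']⟩

theorem IsExtProjective.isTauRigid [FiniteDimensional K A]
    {𝒯 ℱ : ObjectProperty (ModuleCat.{u} A)} (h𝒯 : IsTorsionTheory 𝒯 ℱ) {M : ModuleCat.{u} A}
    (hM : IsExtProjective 𝒯 M) : IsTauRigid K M := by
  have : IsArtinianRing A := IsArtinianRing.of_finite K A
  refine ⟨h𝒯.torsion.finite M hM.1, fun P g => ?_⟩
  have := P.isCover_p.projective
  have := P.isCover_p.finite
  have := P.isCover_q.projective
  have := P.isCover_q.finite
  have h0 := Nakayama.eq_zero_of_forall_factor K P.d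
    ((LinearMap.ker (Nakayama.map K P.d)).subtype ∘ₗ g.hom) (fun x => (g.hom x).2)
    fun x k => hM.exists_factor_d h𝒯 P (LinearMap.toSpanSingleton A M x ∘ₗ k)
  exact ModuleCat.hom_ext (LinearMap.ext fun x => Subtype.ext (LinearMap.congr_fun h0 x))

end TauRigid

/-! ### The structure of functorially finite torsion classes -/

theorem mainTheorem8 {K A : Type u} [Field K] [IsAlgClosed K] [Ring A] [Algebra K A]
    [FiniteDimensional K A]
    (𝒯 : ObjectProperty (ModuleCat.{u} A)) (h𝒯 : IsTorsionClass 𝒯)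
    (hff : IsFunctoriallyFinite 𝒯)
    (T : ModuleCat.{u} A) (f : ModuleCat.of A A ⟶ T) (hf : IsEnvelope 𝒯 f)
    (T' : ModuleCat.{u} A) (hT' : T' = ModuleCat.of A (T × (T ⧸ LinearMap.range f.hom))) :
    (𝒯 = genClass T ∧ 𝒯 = genClass T') ∧
    IsSplitProjective 𝒯 T ∧
    (IsExtProjective 𝒯 T ∧ IsExtProjective 𝒯 T' ∧ IsTauRigid K T ∧ IsTauRigid K T') ∧
    (∀ X : ModuleCat.{u} A, 𝒯 X → ∃ (W : ModuleCat.{u} A) (φ : W ⟶ X),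
      addClass T' W ∧ Function.Surjective φ.hom ∧ 𝒯 (ModuleCat.of A (LinearMap.ker φ.hom))) ∧
    (∀ S : ModuleCat.{u} A, IsExtProjective 𝒯 S → addClass T' S) := by
  subst hT'
  obtain ⟨ℱ, h⟩ := h𝒯
  let C : ModuleCat.{u} A := ModuleCat.of A (T ⧸ LinearMap.range f.hom)
  let T' : ModuleCat.{u} A := ModuleCat.of A (T × C)
  have hC : 𝒯 C := h.mem_of_surjective hf.mem (LinearMap.range f.hom).mkQ
    (Submodule.mkQ_surjective _)
  have hT' : 𝒯 T' := (h.torsion.sum T C).1 ⟨hf.mem, hC⟩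
  have := h.torsion.finite T' hT'
  have hgenT : ∀ X : ModuleCat.{u} A, 𝒯 X → ∀ x : X, ∃ (g : T →ₗ[A] X) (t : T), g t = x :=
    fun X hX x => by
      obtain ⟨g, hg⟩ := hf.exists_map_apply_eq hX x
      exact ⟨g, f.hom (1 : A), (hg 1).trans (one_smul A x)⟩
  have hgenT' : ∀ X : ModuleCat.{u} A, 𝒯 X → ∀ x : X, ∃ (g : T' →ₗ[A] X) (t : T'), g t = x :=
    fun X hX x => by
      obtain ⟨g, t, hg⟩ := hgenT X hX x
      exact ⟨g ∘ₗ LinearMap.fst A T C, (t, 0), hg⟩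
  have hextT : IsExtProjective 𝒯 T := h.isExtProjective_of_isSplitProjective hf.isSplitProjective
  have hextT' : IsExtProjective 𝒯 T' := hextT.prod h.torsion (hf.isExtProjective_coker hextT hC)
  have hcover : ∀ X : ModuleCat.{u} A, 𝒯 X → ∃ (W : ModuleCat.{u} A) (φ : W ⟶ X),
      addClass T' W ∧ Function.Surjective φ.hom ∧
        𝒯 (ModuleCat.of A (LinearMap.ker φ.hom)) := fun X hX => by
    have := h.torsion.finite X hX
    obtain ⟨n, φ, hφ⟩ := exists_right_approximation K (A := A) (M := T') (X := X)
    have hW : addClass T' (ModuleCat.of A (Fin n → T')) :=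
      (isModuleClass_addClass T').fin_pi (addClass_self T') n
    refine ⟨_, ModuleCat.ofHom φ, hW, fun x => ?_, ?_⟩
    · obtain ⟨g, t, rfl⟩ := hgenT' X hX x
      obtain ⟨s, hs⟩ := hφ g
      exact ⟨s t, hs t⟩
    · have : IsNoetherianRing A := IsNoetherianRing.of_finite K A
      have : Module.Finite A (ModuleCat.of A (LinearMap.ker φ)) :=
        inferInstanceAs (Module.Finite A (LinearMap.ker φ))
      have := h.torsion.finite T hf.mem
      refine h.mem_of_genClass hf.mem (genClass_of_forall_exists_map
        (hf.exists_map_to_ker (hW 𝒯 h.torsion hT') φ fun g => ?_))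
      obtain ⟨s, hs⟩ := hφ (g ∘ₗ LinearMap.snd A T C)
      exact ⟨s ∘ₗ LinearMap.inr A T C, fun c => hs (0, c)⟩
  refine ⟨⟨h.eq_genClass hf.mem hgenT, h.eq_genClass hT' hgenT'⟩, hf.isSplitProjective,
    ⟨hextT, hextT', hextT.isTauRigid K h, hextT'.isTauRigid K h⟩, hcover, fun S hS => ?_⟩
  obtain ⟨W, φ, hW, hφ, hker⟩ := hcover S hS.1
  -- The surjection onto `S` splits, because `S` is Ext-projective and the kernel lies in `𝒯`.
  obtain ⟨s, hs⟩ := exists_lift_of_subsingleton_ext (hS.2 _ hker) (LinearMap.ker φ.hom).subtype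
    φ.hom Subtype.val_injective (LinearMap.exact_subtype_ker_map φ.hom) hφ LinearMap.id
  exact (isModuleClass_addClass T').of_retract hW s φ.hom hs
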